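/- **Theorem (posterior consistency of the R2-D2 prior).** For every $n$ let $p_n\ge 1$ be an integer, $\mathbf X_n$ a (fixed) real $n\times p_n$ design matrix and $\beta_n^0\in\mathbb R^{p_n}$ the true coefficient vector, and let the data follow the Gaussian linear model $Y_n=\mathbf X_n\beta_n^0+\varepsilon_n$, where, for each $n$, $\varepsilon_{n1},\dots,\varepsilon_{nn}$ are independent $N(0,\sigma^2)$ with $\sigma>0$ known and fixed. All $\varepsilon_n$ are defined on one probability space; nothing is assumed about their joint law across different $n$. Assume: 1. $p_n=o(n)$; 2. $0<d_{\min}<\liminf_{n\to\infty}d_{p_n}\le\limsup_{n\to\infty}d_1<d_{\max}<\infty$ for fixed $d_{\min},d_{\max}$, where $d_{p_n}$ and $d_1$ are the smallest and the largest eigenvalue of $\mathbf X_n^T\mathbf X_n/n$; 3. $\limsup_{n\to\infty}\max_{1\le j\le p_n}|\beta^0_{nj}|<\infty$; 4. $q_n=o(n/\log n)$, where $q_n$ is the number of nonzero components of $\beta_n^0$. Let $b>0$, $\rho>0$, $C>0$ and $a_\pi=a_{\pi,n}=C/(p_n^{b/2}\,n^{\rho b/2}\log n)$. Give $\beta_n=(\beta_{n1},\dots,\beta_{np_n})$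 the R2-D2 prior $$\xi\sim\mathrm{Ga}(b,1),\qquad \lambda_j\mid\xi\sim\mathrm{Ga}(a_\pi,\xi),\qquad \beta_{nj}\mid\lambda_j\sim\mathrm{DE}\big(\sigma(\lambda_j/2)^{1/2}\big),\qquad j=1,\dots,p_n,$$ where the $\lambda_j$ are independent given $\xi$ and the $\beta_{nj}$ are independent given $(\lambda_1,\dots,\lambda_{p_n})$; $\mathrm{Ga}(\mu,\nu)$ is the Gamma distribution with shape $\mu$ and rate $\nu$, and $\mathrm{DE}(\delta)$ is the double-exponential distribution with density $(2\delta)^{-1}e^{-|x|/\delta}$. Let $\mathrm{pr}(\,\cdot\mid Y_n)$ be the posterior distribution of $\beta_n$ given by Bayes' formula for this prior and the Gaussian likelihood with known variance $\sigma^2$. Then the posterior is consistent: for every $\epsilon>0$, $$\mathrm{pr}\big(\beta_n:\ \|\beta_n-\beta_n^0\|>\epsilon\mid Y_n\big)\longrightarrow 0\qquad(n\to\infty),$$ both in probability and almost surely, where $\|\cdot\|$ is the Euclidean norm. -/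

import Mathlib

open MeasureTheory ProbabilityTheory Filter Topology Asymptotics
open scoped ENNReal NNReal Matrix

/-- Density at `x` of the double-exponential distribution `DE(δ)` with mean `0` and scale `δ > 0`
(hence variance `2 δ ^ 2`). -/
noncomputable def doubleExpPDF (δ x : ℝ) : ℝ≥0∞ :=
  ENNReal.ofReal ((2 * δ)⁻¹ * Real.exp (-(|x| / δ)))

/-- Joint density, with respect to Lebesgue measure, of `(ξ, l, β)` in the hierarchy
`ξ ~ Ga(b, 1)`, `l j ∣ ξ ~ Ga(a, ξ)` independently over `j` given `ξ`, and
`β j ∣ l ~ DE(σ * √(l j / 2))` independently over `j` given `l`.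
Here `gammaPDF shape rate` is the density of the Gamma distribution. -/
noncomputable def r2d2JointPDF (p : ℕ) (σ a b : ℝ) (z : ℝ × (Fin p → ℝ) × (Fin p → ℝ)) : ℝ≥0∞ :=
  gammaPDF b 1 z.1 * (∏ j, gammaPDF a z.1 (z.2.1 j)) *
    ∏ j, doubleExpPDF (σ * √(z.2.1 j / 2)) (z.2.2 j)

/-- The R2-D2 prior on the coefficient vector `β ∈ ℝ^p`: the `β`-marginal of the hierarchy. -/
noncomputable def r2d2Prior (p : ℕ) (σ a b : ℝ) : Measure (Fin p → ℝ) :=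
  ((volume : Measure (ℝ × (Fin p → ℝ) × (Fin p → ℝ))).withDensity (r2d2JointPDF p σ a b)).map
    (fun z => z.2.2)

/-- Likelihood of `β` in the Gaussian linear model `y = X β + e`, where the `e i` are independent
`N(0, σ ^ 2)`. -/
noncomputable def linearModelLikelihood {n p : ℕ} (X : Matrix (Fin n) (Fin p) ℝ) (σ : ℝ)
    (y : Fin n → ℝ) (β : Fin p → ℝ) : ℝ≥0∞ :=
  ∏ i, gaussianPDF ((X *ᵥ β) i) (σ ^ 2).toNNReal (y i)

/-- Posterior probability of the set `S` of coefficient vectors given the data `y`, for the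
prior `μ` (Bayes' formula). -/
noncomputable def posteriorProb {n p : ℕ} (X : Matrix (Fin n) (Fin p) ℝ) (σ : ℝ)
    (μ : Measure (Fin p → ℝ)) (y : Fin n → ℝ) (S : Set (Fin p → ℝ)) : ℝ≥0∞ :=
  (∫⁻ β in S, linearModelLikelihood X σ y β ∂μ) / ∫⁻ β, linearModelLikelihood X σ y β ∂μ

/-- The matrix `Xᵀ X / n`. -/
noncomputable def scaledGram {n p : ℕ} (X : Matrix (Fin n) (Fin p) ℝ) : Matrix (Fin p) (Fin p) ℝ :=
  (n : ℝ)⁻¹ • (Xᵀ * X)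

theorem scaledGram_isHermitian {n p : ℕ} (X : Matrix (Fin n) (Fin p) ℝ) :
    (scaledGram X).IsHermitian := by
  simp [scaledGram, Matrix.IsHermitian, Matrix.transpose_mul]

/-- Smallest eigenvalue (equivalently, singular value) of `Xᵀ X / n`, as an extended real. -/
noncomputable def minEigenvalue {n p : ℕ} (X : Matrix (Fin n) (Fin p) ℝ) : EReal :=
  ⨅ j, ((scaledGram_isHermitian X).eigenvalues j : EReal)

/-- Largest eigenvalue (equivalently, singular value) of `Xᵀ X / n`, as an extended real. -/
noncomputable def maxEigenvalue {n p : ℕ} (X : Matrix (Fin n) (Fin p) ℝ) : EReal :=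
  ⨆ j, ((scaledGram_isHermitian X).eigenvalues j : EReal)

/-! Write `h = β - β₀`. The likelihood ratio of `β` to `β₀` is `exp ((2 (Xᵀe)·h - |Xh|²) / (2σ²))`,
so the noise enters only through the score `Xᵀe`, and the eigenvalue bounds make `|Xh|²` comparable
to `n |h|²`.

Score: a Chernoff bound for `|Xᵀe|²` (`measure_le_sq_transpose_mulVec_le`) gives `|Xᵀe| ≤ dmin ε n /
4` outside an event of probability at most `2 ^ p exp (-c n)`, which is exponentially small because
`p = o(n)`. Off this event the ratio is exponentially small for `|h| > ε`, and decays at a much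
slower rate for `|h| ≤ r` with `r` small (`posteriorProb_le`).

Prior: it remains to show that the ball of radius `r` has prior mass at least `exp (-κ n)` for each
`κ > 0` (`eventually_exp_le_r2d2Prior_box`). The ball contains a box of half-width `r / √p`. Given
`ξ ∈ [1, 2]` the coordinates are independent. A zero coordinate costs only a constant factor, since
its Gamma mass near `0` is of order `p ^ (-a)` and `a log p ≤ C`. A nonzero one costs a power of
`n`. The total cost `O(p + q log n)` is `o(n)`.

Both modes of convergence follow from the exponential bounds, the almost sure one by Borel–Cantelli.
-/

theorem lintegral_pi_prod_eq_prod {p : ℕ} {α : Type*} [MeasurableSpace α]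
    (μ : Fin p → Measure α) [∀ i, SigmaFinite (μ i)] (f : Fin p → α → ℝ≥0∞)
    (hf : ∀ i, Measurable (f i)) :
    ∫⁻ x, ∏ i, f i (x i) ∂(Measure.pi μ) = ∏ i, ∫⁻ x, f i x ∂(μ i) := by
  induction p with
  | zero => simp
  | succ p ih =>
    calc
      _ = ∫⁻ x : α × (Fin p → α), f 0 x.1 * ∏ i : Fin p, f i.succ (x.2 i)
            ∂((μ 0).prod (Measure.pi fun i => μ i.succ)) := by
          rw [← (measurePreserving_piFinSuccAbove μ 0).symm.lintegral_comp_emb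
            (MeasurableEquiv.measurableEmbedding _)]
          simp_rw [MeasurableEquiv.piFinSuccAbove_symm_apply, Fin.insertNthEquiv,
            Fin.prod_univ_succ, Fin.insertNth_zero, Equiv.coe_fn_mk, Fin.cons_succ,
            Fin.zero_succAbove, Fin.cons_zero]
          rfl
      _ = (∫⁻ x, f 0 x ∂μ 0) * ∏ i : Fin p, ∫⁻ x, f i.succ x ∂(μ i.succ) := by
          rw [← ih (fun i => μ i.succ) (fun i => f i.succ) fun i => hf _]
          exact lintegral_prod_mul (f := f 0) (g := fun y : Fin p → α => ∏ i : Fin p, f i.succ (y i))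
            (hf 0).aemeasurable (Finset.measurable_fun_prod _ fun i _ =>
              (hf _).comp (measurable_pi_apply i)).aemeasurable
      _ = ∏ i, ∫⁻ x, f i x ∂(μ i) := by rw [Fin.prod_univ_succ]

/-- Here `w` is the coordinate vector of `h` in an orthonormal eigenbasis. -/
theorem dotProduct_mulVec_eq_sum_eigenvalues {p : ℕ} {A : Matrix (Fin p) (Fin p) ℝ}
    (hA : A.IsHermitian) (h : Fin p → ℝ) :
    ∃ w : Fin p → ℝ, w ⬝ᵥ w = h ⬝ᵥ h ∧ h ⬝ᵥ (A *ᵥ h) = ∑ j, hA.eigenvalues j * w j ^ 2 := by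
  obtain ⟨U, hU⟩ : ∃ U : Matrix (Fin p) (Fin p) ℝ, U = hA.eigenvectorUnitary := ⟨_, rfl⟩
  have hUU : U * star U = 1 := by
    rw [hU]; exact Unitary.coe_mul_star_self hA.eigenvectorUnitary
  have hs : A = U * Matrix.diagonal hA.eigenvalues * star U := by
    conv_lhs => rw [hA.spectral_theorem]
    simp [Unitary.conjStarAlgAut_apply, hU]
  have ht : star U = Uᵀ := by simp [Matrix.star_eq_conjTranspose]
  rw [ht] at hs hUU
  have key : ∀ B : Matrix (Fin p) (Fin p) ℝ,
      h ⬝ᵥ ((U * B * Uᵀ) *ᵥ h) = (Uᵀ *ᵥ h) ⬝ᵥ (B *ᵥ (Uᵀ *ᵥ h)) := by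
    intro B
    rw [← Matrix.mulVec_mulVec, ← Matrix.mulVec_mulVec, Matrix.dotProduct_mulVec,
      Matrix.mulVec_transpose]
  refine ⟨Uᵀ *ᵥ h, ?_, ?_⟩
  · have := key 1
    rw [mul_one, hUU, Matrix.one_mulVec, Matrix.one_mulVec] at this
    exact this.symm
  · conv_lhs => rw [hs, key]
    simp only [dotProduct, Matrix.mulVec_diagonal]
    exact Finset.sum_congr rfl fun j _ => by ring

theorem dotProduct_self_mulVec_eq {n p : ℕ} (X : Matrix (Fin n) (Fin p) ℝ) (hn : 0 < n) (h : Fin p → ℝ) :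
    (X *ᵥ h) ⬝ᵥ (X *ᵥ h) = n * (h ⬝ᵥ (scaledGram X *ᵥ h)) := by
  have : (n : ℝ) ≠ 0 := by positivity
  rw [scaledGram, Matrix.smul_mulVec, dotProduct_smul, smul_eq_mul, mul_inv_cancel_left₀ this,
    ← Matrix.mulVec_mulVec, Matrix.dotProduct_mulVec h, ← Matrix.mulVec_transpose,
    Matrix.transpose_transpose]

/-! ### Gaussian exponential moments and the tail of the score -/

theorem lintegral_exp_dotProduct_gaussian {p : ℕ} (v : ℝ≥0) (u : Fin p → ℝ) :
    ∫⁻ x, ENNReal.ofReal (Real.exp (u ⬝ᵥ x)) ∂(Measure.pi fun _ : Fin p => gaussianReal 0 v)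
      = ENNReal.ofReal (Real.exp (v * (u ⬝ᵥ u) / 2)) := by
  have h1 : ∀ x : Fin p → ℝ, ENNReal.ofReal (Real.exp (u ⬝ᵥ x))
      = ∏ i, ENNReal.ofReal (Real.exp (u i * x i)) := fun x => by
    rw [dotProduct, Real.exp_sum, ENNReal.ofReal_prod_of_nonneg fun i _ => (Real.exp_pos _).le]
  simp_rw [h1]
  rw [lintegral_pi_prod_eq_prod _ (fun i x => ENNReal.ofReal (Real.exp (u i * x)))
    fun i => by fun_prop]
  have h2 : ∀ i, ∫⁻ x, ENNReal.ofReal (Real.exp (u i * x)) ∂(gaussianReal 0 v)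
      = ENNReal.ofReal (Real.exp (v * u i ^ 2 / 2)) := fun i => by
    rw [← ofReal_integral_eq_lintegral_ofReal (integrable_exp_mul_gaussianReal _)
      (ae_of_all _ fun _ => (Real.exp_pos _).le)]
    have := congrFun (mgf_fun_id_gaussianReal (μ := 0) (v := v)) (u i)
    simp only [mgf] at this
    rw [this]; simp
  simp_rw [h2]
  rw [← ENNReal.ofReal_prod_of_nonneg fun i _ => (Real.exp_pos _).le, ← Real.exp_sum]
  congr 2
  simp only [dotProduct, Finset.mul_sum, Finset.sum_div, sq]

/-- Against the standard normal density the integrand becomes `√2` times the `N(0, 2)` density, and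
`√2 ≤ 2`. -/
theorem lintegral_exp_sq_gaussian_le :
    ∫⁻ x, ENNReal.ofReal (Real.exp (x ^ 2 / 4)) ∂(gaussianReal 0 1) ≤ 2 := by
  rw [gaussianReal_of_var_ne_zero _ one_ne_zero,
    lintegral_withDensity_eq_lintegral_mul _ (measurable_gaussianPDF _ _) (by fun_prop)]
  have : ∀ x : ℝ, (gaussianPDF 0 1 * fun x => ENNReal.ofReal (Real.exp (x ^ 2 / 4))) x
      ≤ 2 * gaussianPDF 0 2 x := by
    intro x
    simp only [Pi.mul_apply, gaussianPDF]
    rw [← ENNReal.ofReal_ofNat 2, ← ENNReal.ofReal_mul (gaussianPDFReal_nonneg _ _ _),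
      ← ENNReal.ofReal_mul (by norm_num)]
    apply ENNReal.ofReal_le_ofReal
    simp only [gaussianPDFReal, NNReal.coe_one, NNReal.coe_ofNat, mul_one, sub_zero]
    rw [mul_assoc, ← Real.exp_add, ← mul_assoc]
    have e1 : -x ^ 2 / 2 + x ^ 2 / 4 = -x ^ 2 / (2 * 2) := by ring
    rw [e1]
    gcongr
    rw [Real.sqrt_mul (by positivity) 2, mul_inv]
    have h2 : 1 ≤ (√2)⁻¹ * 2 := by
      have := Real.sqrt_nonneg 2
      rw [← div_eq_inv_mul, Real.div_sqrt]
      exact Real.one_le_sqrt.2 (by norm_num)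
    nlinarith [inv_nonneg.2 (Real.sqrt_nonneg (2 * Real.pi))]
  calc _ ≤ ∫⁻ x, 2 * gaussianPDF 0 2 x := lintegral_mono this
    _ = 2 := by
      rw [lintegral_const_mul _ (measurable_gaussianPDF _ _),
        lintegral_gaussianPDF_eq_one _ (by norm_num), mul_one]

/-- Exponential moment of the squared norm of `Xᵀ e` for Gaussian noise `e`. -/
theorem lintegral_exp_sq_transpose_mulVec_le {n p : ℕ} (X : Matrix (Fin n) (Fin p) ℝ)
    (v : ℝ≥0) (s : ℝ) (hs : 0 ≤ s)
    (hX : ∀ h : Fin p → ℝ, s * (v * ((X *ᵥ h) ⬝ᵥ (X *ᵥ h))) ≤ (h ⬝ᵥ h) / 2) :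
    ∫⁻ x, ENNReal.ofReal (Real.exp (s * ((Xᵀ *ᵥ x) ⬝ᵥ (Xᵀ *ᵥ x)) / 2))
      ∂(Measure.pi fun _ : Fin n => gaussianReal 0 v) ≤ 2 ^ p := by
  have swap : ∀ (x : Fin n → ℝ) (g : Fin p → ℝ), (Xᵀ *ᵥ x) ⬝ᵥ g = (X *ᵥ g) ⬝ᵥ x := fun x g => by
    rw [dotProduct_comm (X *ᵥ g), Matrix.dotProduct_mulVec, Matrix.mulVec_transpose]
  -- Linearise the square: `exp (|u|² / 2)` is the moment generating function of a standard Gaussian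
  -- `g` at `u = √s Xᵀx`. After the swap, `x` is integrated first, and `hX` leaves a product of
  -- one-dimensional moments in `g`.
  have h1 : ∀ x : Fin n → ℝ, ENNReal.ofReal (Real.exp (s * ((Xᵀ *ᵥ x) ⬝ᵥ (Xᵀ *ᵥ x)) / 2))
      = ∫⁻ g, ENNReal.ofReal (Real.exp ((√s • (X *ᵥ g)) ⬝ᵥ x))
        ∂(Measure.pi fun _ : Fin p => gaussianReal 0 1) := fun x => by
    have := lintegral_exp_dotProduct_gaussian 1 (√s • (Xᵀ *ᵥ x))
    simp only [smul_dotProduct, dotProduct_smul, smul_eq_mul, NNReal.coe_one, one_mul, swap,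
      ← mul_assoc, Real.mul_self_sqrt hs] at this ⊢
    exact this.symm
  simp_rw [h1]
  rw [lintegral_lintegral_swap]
  · simp_rw [lintegral_exp_dotProduct_gaussian]
    calc _ ≤ ∫⁻ g : Fin p → ℝ, ∏ i, ENNReal.ofReal (Real.exp (g i ^ 2 / 4))
          ∂(Measure.pi fun _ : Fin p => gaussianReal 0 1) := by
          refine lintegral_mono fun g => ?_
          rw [← ENNReal.ofReal_prod_of_nonneg fun i _ => (Real.exp_pos _).le, ← Real.exp_sum]
          refine ENNReal.ofReal_le_ofReal (Real.exp_le_exp.2 ?_)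
          have h3 := hX g
          simp only [smul_dotProduct, dotProduct_smul, smul_eq_mul]
          rw [← mul_assoc (√s), Real.mul_self_sqrt hs, ← Finset.sum_div]
          have : ∑ i, g i ^ 2 = g ⬝ᵥ g := by simp [dotProduct, sq]
          rw [this]
          linarith
      _ = ∏ i : Fin p, ∫⁻ x, ENNReal.ofReal (Real.exp (x ^ 2 / 4)) ∂(gaussianReal 0 1) :=
          lintegral_pi_prod_eq_prod _ (fun _ x => ENNReal.ofReal (Real.exp (x ^ 2 / 4)))
            fun _ => by fun_prop
      _ ≤ ∏ _i : Fin p, 2 := Finset.prod_le_prod' fun _ _ => lintegral_exp_sq_gaussian_le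
      _ = 2 ^ p := by simp
  · refine Measurable.aemeasurable ?_
    refine ENNReal.measurable_ofReal.comp (Real.measurable_exp.comp ?_)
    apply Continuous.measurable
    simp only [dotProduct]
    fun_prop

/-- Markov's inequality for `exp (s |Xᵀe|² / 2)`; the choice `s = 1 / (2σ²l)` is the largest that
the moment bound admits for a given `l`. -/
theorem measure_le_sq_transpose_mulVec_le {n p : ℕ} (X : Matrix (Fin n) (Fin p) ℝ)
    {σ l : ℝ} (hσ : 0 < σ) (hl : 0 < l)
    (hX : ∀ h : Fin p → ℝ, (X *ᵥ h) ⬝ᵥ (X *ᵥ h) ≤ l * (h ⬝ᵥ h))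
    {Ω : Type*} [MeasurableSpace Ω] (P : Measure Ω) (e : Fin n → Ω → ℝ)
    (he_law : ∀ i, HasLaw (e i) (gaussianReal 0 (σ ^ 2).toNNReal) P) (he_indep : iIndepFun e P)
    (c : ℝ) :
    P {ω | c ≤ (Xᵀ *ᵥ fun i => e i ω) ⬝ᵥ (Xᵀ *ᵥ fun i => e i ω)}
      ≤ ENNReal.ofReal (2 ^ p * Real.exp (-(c / (4 * σ ^ 2 * l)))) := by
  have law := he_indep.hasLaw_pi he_law
  have hm : Measurable fun x : Fin n → ℝ => (Xᵀ *ᵥ x) ⬝ᵥ (Xᵀ *ᵥ x) := by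
    apply Continuous.measurable
    simp only [dotProduct, Matrix.mulVec]
    fun_prop
  set s : ℝ := 1 / (2 * σ ^ 2 * l) with hs
  have hs0 : 0 < s := by positivity
  have hM := lintegral_exp_sq_transpose_mulVec_le X (σ ^ 2).toNNReal s hs0.le fun h => by
    rw [Real.coe_toNNReal _ (sq_nonneg σ)]
    have h1 : s * (σ ^ 2 * (l * (h ⬝ᵥ h))) = (h ⬝ᵥ h) / 2 := by rw [hs]; field_simp
    rw [← h1]
    gcongr
    exact hX h
  have hMa := mul_meas_ge_le_lintegral₀ (μ := Measure.pi fun _ : Fin n =>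
      gaussianReal 0 (σ ^ 2).toNNReal) (f := fun x => ENNReal.ofReal (Real.exp (s * ((Xᵀ *ᵥ x) ⬝ᵥ (Xᵀ *ᵥ x)) / 2)))
      (by fun_prop) (ENNReal.ofReal (Real.exp (s * c / 2)))
  have hset : {x : Fin n → ℝ | ENNReal.ofReal (Real.exp (s * c / 2)) ≤
      ENNReal.ofReal (Real.exp (s * ((Xᵀ *ᵥ x) ⬝ᵥ (Xᵀ *ᵥ x)) / 2))}
      = {x | c ≤ (Xᵀ *ᵥ x) ⬝ᵥ (Xᵀ *ᵥ x)} := by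
    ext x
    simp only [Set.mem_ofPred_eq]
    rw [ENNReal.ofReal_le_ofReal_iff (Real.exp_pos _).le, Real.exp_le_exp,
      div_le_div_iff_of_pos_right two_pos, mul_le_mul_iff_right₀ hs0]
  rw [hset, ← law.measure_eq (p := fun x => c ≤ (Xᵀ *ᵥ x) ⬝ᵥ (Xᵀ *ᵥ x))
    (measurableSet_le measurable_const hm)] at hMa
  have h4 := hMa.trans hM
  have h5 : s * c / 2 = c / (4 * σ ^ 2 * l) := by rw [hs]; field_simp; ring
  rw [h5] at h4
  rw [ENNReal.ofReal_mul (by positivity), Real.exp_neg,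
    ENNReal.ofReal_inv_of_pos (Real.exp_pos _), ENNReal.ofReal_pow (by norm_num),
    ENNReal.ofReal_ofNat, ← div_eq_mul_inv, ENNReal.le_div_iff_mul_le
      (Or.inl (by simp [Real.exp_pos])) (Or.inl ENNReal.ofReal_ne_top), mul_comm]
  exact h4

/-! ### Prior mass of boxes -/

theorem measurable_gammaPDF_rate (a : ℝ) : Measurable fun z : ℝ × ℝ => gammaPDF a z.1 z.2 := by
  unfold gammaPDF gammaPDFReal
  refine ENNReal.measurable_ofReal.comp (Measurable.ite ?_ (by fun_prop) (by fun_prop))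
  exact measurableSet_le measurable_const measurable_snd

theorem measurable_doubleExpPDF : Measurable fun z : ℝ × ℝ => doubleExpPDF z.1 z.2 := by
  unfold doubleExpPDF
  fun_prop

/-- Prior mass of a box, with the local scales and the coefficients integrated out one by one. -/
theorem r2d2Prior_box (p : ℕ) (σ a b : ℝ) (B : Fin p → Set ℝ) (hB : ∀ j, MeasurableSet (B j)) :
    r2d2Prior p σ a b {β | ∀ j, β j ∈ B j} = ∫⁻ ξ, gammaPDF b 1 ξ *
      ∏ j, ∫⁻ l, gammaPDF a ξ l * ∫⁻ x in B j, doubleExpPDF (σ * √(l / 2)) x := by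
  have hg := measurable_gammaPDF_rate a
  have hd := measurable_doubleExpPDF
  have hdj : ∀ j, Measurable fun w : ℝ × ℝ =>
      (B j).indicator (doubleExpPDF (σ * √(w.1 / 2))) w.2 := fun j => by
    have : (fun w : ℝ × ℝ => (B j).indicator (doubleExpPDF (σ * √(w.1 / 2))) w.2)
        = (Prod.snd ⁻¹' B j).indicator fun w => doubleExpPDF (σ * √(w.1 / 2)) w.2 := by
      ext w; rfl
    rw [this]
    exact (hd.comp (f := fun w : ℝ × ℝ => (σ * √(w.1 / 2), w.2)) (by fun_prop)).indicator
      (measurable_snd (hB j))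
  have hmeas : MeasurableSet {β : Fin p → ℝ | ∀ j, β j ∈ B j} := by
    simp only [Set.ofPred_forall]
    exact MeasurableSet.iInter fun j => measurable_pi_apply j (hB j)
  have hb1 : Measurable (gammaPDF b 1) :=
    (measurable_gammaPDF_rate b).comp (f := fun x : ℝ => (1, x)) (by fun_prop)
  have hgj : ∀ j, Measurable fun z : ℝ × (Fin p → ℝ) × (Fin p → ℝ) =>
      gammaPDF a z.1 (z.2.1 j) := fun j =>
    hg.comp (f := fun z : ℝ × (Fin p → ℝ) × (Fin p → ℝ) => (z.1, z.2.1 j)) (by fun_prop)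
  have hDj : ∀ j, Measurable fun z : ℝ × (Fin p → ℝ) × (Fin p → ℝ) =>
      (B j).indicator (doubleExpPDF (σ * √(z.2.1 j / 2))) (z.2.2 j) := fun j =>
    (hdj j).comp (f := fun z : ℝ × (Fin p → ℝ) × (Fin p → ℝ) => (z.2.1 j, z.2.2 j)) (by fun_prop)
  have hint : ∀ j, Measurable fun l => ∫⁻ x in B j, doubleExpPDF (σ * √(l / 2)) x := fun j => by
    simp_rw [← lintegral_indicator (hB j)]
    exact (hdj j).lintegral_prod_right'
  have hF : Measurable fun z : ℝ × (Fin p → ℝ) × (Fin p → ℝ) =>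
      gammaPDF b 1 z.1 * (∏ j, gammaPDF a z.1 (z.2.1 j)) *
        ∏ j, (B j).indicator (doubleExpPDF (σ * √(z.2.1 j / 2))) (z.2.2 j) :=
    ((hb1.comp measurable_fst).mul (Finset.measurable_prod _ fun j _ => hgj j)).mul
      (Finset.measurable_prod _ fun j _ => hDj j)
  have hms : MeasurableSet ((fun z : ℝ × (Fin p → ℝ) × (Fin p → ℝ) => z.2.2) ⁻¹'
      {β | ∀ j, β j ∈ B j}) := (measurable_snd.comp measurable_snd) hmeas
  -- Absorbing the box as a product of indicators keeps the integrand factorised over `j`.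
  have hind : ((fun z : ℝ × (Fin p → ℝ) × (Fin p → ℝ) => z.2.2) ⁻¹'
      {β | ∀ j, β j ∈ B j}).indicator (r2d2JointPDF p σ a b) = fun z =>
      gammaPDF b 1 z.1 * (∏ j, gammaPDF a z.1 (z.2.1 j)) *
        ∏ j, (B j).indicator (doubleExpPDF (σ * √(z.2.1 j / 2))) (z.2.2 j) := by
    ext z
    by_cases h : ∀ j, z.2.2 j ∈ B j
    · rw [Set.indicator_of_mem (by simpa using h), r2d2JointPDF]
      congr 1
      exact Finset.prod_congr rfl fun j _ => (Set.indicator_of_mem (h j) _).symm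
    · rw [Set.indicator_of_notMem (by simpa using h)]
      push Not at h
      obtain ⟨j, hj⟩ := h
      exact (mul_eq_zero_of_right _ (Finset.prod_eq_zero (Finset.mem_univ j)
        (Set.indicator_of_notMem hj _))).symm
  rw [r2d2Prior, Measure.map_apply (by fun_prop) hmeas,
    withDensity_apply _ hms, ← lintegral_indicator hms, hind, Measure.volume_eq_prod,
    lintegral_prod _ hF.aemeasurable]
  refine lintegral_congr fun ξ => ?_
  rw [Measure.volume_eq_prod]
  refine (lintegral_prod _ (hF.comp (measurable_prodMk_left (x := ξ))).aemeasurable).trans ?_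
  have inner : ∀ l : Fin p → ℝ, ∫⁻ y : Fin p → ℝ, gammaPDF b 1 ξ * (∏ j, gammaPDF a ξ (l j)) *
      ∏ j, (B j).indicator (doubleExpPDF (σ * √(l j / 2))) (y j)
      = gammaPDF b 1 ξ * ∏ j, (gammaPDF a ξ (l j) *
        ∫⁻ x in B j, doubleExpPDF (σ * √(l j / 2)) x) := fun l => by
    have hm : ∀ j, Measurable ((B j).indicator (doubleExpPDF (σ * √(l j / 2)))) := fun j =>
      (hdj j).comp (f := fun x : ℝ => (l j, x)) (by fun_prop)
    rw [lintegral_const_mul _ (by fun_prop), volume_pi, lintegral_pi_prod_eq_prod _ _ hm,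
      Finset.prod_mul_distrib, mul_assoc]
    simp_rw [lintegral_indicator (hB _)]
  have hgξ : ∀ j, Measurable fun l => gammaPDF a ξ l *
      ∫⁻ x in B j, doubleExpPDF (σ * √(l / 2)) x := fun j =>
    (hg.comp (f := fun x : ℝ => (ξ, x)) (by fun_prop)).mul (hint j)
  simp only [Function.comp_apply, inner]
  have hprod : Measurable fun l : Fin p → ℝ => ∏ j, (gammaPDF a ξ (l j) *
      ∫⁻ x in B j, doubleExpPDF (σ * √(l j / 2)) x) :=
    Finset.measurable_fun_prod _ fun j _ => (hgξ j).comp (measurable_pi_apply j)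
  rw [lintegral_const_mul _ hprod, volume_pi]
  exact congrArg _ (lintegral_pi_prod_eq_prod _ _ hgξ)

/-- The inequality also covers `δ = 0`, where the density vanishes since `0⁻¹ = 0`; this scale
occurs for `l ≤ 0`. -/
theorem lintegral_doubleExpPDF_le_one {δ : ℝ} (hδ : 0 ≤ δ) : ∫⁻ x, doubleExpPDF δ x ≤ 1 := by
  rcases hδ.eq_or_lt with rfl | hδ
  · simp [doubleExpPDF]
  have h1 : ∫ x in Set.Ioi (0 : ℝ), Real.exp (-(δ⁻¹ * x)) = δ := by
    have := integral_exp_mul_Ioi (a := -δ⁻¹) (by simpa using hδ) 0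
    simpa using this
  have hi1 : IntegrableOn (fun x => Real.exp (-(δ⁻¹ * x))) (Set.Ioi (0 : ℝ)) := by
    have := integrableOn_exp_mul_Ioi (a := -δ⁻¹) (by simpa using hδ) 0
    simpa using this
  have hpos : ∫⁻ x in Set.Ioi (0 : ℝ), doubleExpPDF δ x = ENNReal.ofReal (1 / 2) := by
    rw [setLIntegral_congr_fun (g := fun x =>
      ENNReal.ofReal ((2 * δ)⁻¹ * Real.exp (-(δ⁻¹ * x)))) measurableSet_Ioi,
      ← ofReal_integral_eq_lintegral_ofReal (hi1.const_mul _) (ae_of_all _ fun x => by positivity),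
      integral_const_mul, h1]
    · congr 1; field_simp
    · intro x hx
      simp only [doubleExpPDF, abs_of_pos (Set.mem_Ioi.1 hx), div_eq_inv_mul]
  have hneg : ∫⁻ x in Set.Iic (0 : ℝ), doubleExpPDF δ x = ENNReal.ofReal (1 / 2) := by
    rw [← hpos, setLIntegral_congr Iio_ae_eq_Iic.symm]
    have := (Measure.measurePreserving_neg (volume : Measure ℝ)).setLIntegral_comp_emb
      (MeasurableEquiv.neg ℝ).measurableEmbedding (doubleExpPDF δ) (Set.Ioi 0)
    simp only [Set.image_neg_eq_neg, Set.neg_Ioi, neg_zero] at this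
    rw [← this]
    exact lintegral_congr fun x => by simp [doubleExpPDF]
  rw [← lintegral_add_compl _ measurableSet_Ioi, Set.compl_Ioi, hpos, hneg,
    ← ENNReal.ofReal_add (by norm_num) (by norm_num)]
  norm_num

theorem r2d2Prior_univ_le_one (p : ℕ) {σ a b : ℝ} (hσ : 0 ≤ σ) (ha : 0 < a) (hb : 0 < b) :
    r2d2Prior p σ a b Set.univ ≤ 1 := by
  have h := r2d2Prior_box p σ a b (fun _ => Set.univ) fun _ => MeasurableSet.univ
  simp only [Set.mem_univ, implies_true, Set.ofPred_true, Measure.restrict_univ] at h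
  rw [h, ← lintegral_gammaPDF_eq_one hb one_pos]
  have h0 : ∀ᵐ ξ : ℝ, ξ ≠ 0 := by simp [ae_iff]
  refine lintegral_mono_ae (h0.mono fun ξ hξ => ?_)
  rcases hξ.lt_or_gt with hξ | hξ
  · simp [gammaPDF_of_neg hξ]
  refine mul_le_of_le_one_right' (Finset.prod_le_one' fun j _ => ?_)
  rw [← lintegral_gammaPDF_eq_one ha hξ]
  exact lintegral_mono fun l => mul_le_of_le_one_right'
    (lintegral_doubleExpPDF_le_one (by positivity))

/-- Convexity of `Γ` on `[1, 2]`, with value `1` at both ends. -/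
theorem Real.Gamma_add_one_le_one {a : ℝ} (ha : 0 ≤ a) (ha1 : a ≤ 1) : Real.Gamma (a + 1) ≤ 1 := by
  have := Real.convexOn_Gamma.2 (x := 1) (y := 2) (by simp) (by simp)
    (sub_nonneg.2 ha1) ha (by ring)
  simp only [smul_eq_mul, Real.Gamma_one, Real.Gamma_two] at this
  calc Real.Gamma (a + 1) = Real.Gamma ((1 - a) * 1 + a * 2) := by ring_nf
    _ ≤ 1 := by linarith

/-- The bound is uniform in `ξ`: `ξ ^ a / Γ(a) ≥ 1 / Γ(a) = a / Γ(a + 1) ≥ a`. -/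
theorem le_gammaPDF {a ξ l T : ℝ} (ha : 0 < a) (ha1 : a ≤ 1) (hξ : ξ ∈ Set.Icc (1 : ℝ) 2)
    (hl : 0 ≤ l) (hlT : l ≤ T) :
    ENNReal.ofReal (a * l ^ (a - 1) * Real.exp (-(2 * T))) ≤ gammaPDF a ξ l := by
  rw [gammaPDF_of_nonneg hl]
  have hΓ := Real.Gamma_pos_of_pos ha
  have h1 : a ≤ ξ ^ a / Real.Gamma a := by
    rw [le_div_iff₀ hΓ, ← Real.Gamma_add_one ha.ne']
    exact (Real.Gamma_add_one_le_one ha.le ha1).trans (Real.one_le_rpow hξ.1 ha.le)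
  refine ENNReal.ofReal_le_ofReal ?_
  have h2 : ξ * l ≤ 2 * T := mul_le_mul hξ.2 hlT hl (by norm_num)
  have h3 : 0 ≤ ξ ^ a / Real.Gamma a := ha.le.trans h1
  have h4 := Real.rpow_nonneg hl (a - 1)
  gcongr

/-- Integrating `a l ^ (a - 1)` gives `t ^ a`: the small factor `a` disappears, which is why zero
coefficients are cheap. -/
theorem le_setLIntegral_Ioc_gammaPDF {a ξ t : ℝ} (ha : 0 < a) (ha1 : a ≤ 1)
    (hξ : ξ ∈ Set.Icc (1 : ℝ) 2) (ht : 0 < t) :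
    ENNReal.ofReal (t ^ a * Real.exp (-(2 * t))) ≤ ∫⁻ l in Set.Ioc 0 t, gammaPDF a ξ l := by
  have hI : ∫ l in Set.Ioc 0 t, a * l ^ (a - 1) * Real.exp (-(2 * t))
      = t ^ a * Real.exp (-(2 * t)) := by
    rw [integral_mul_const, integral_const_mul, ← intervalIntegral.integral_of_le ht.le,
      integral_rpow (Or.inl (by linarith))]
    simp only [sub_add_cancel, Real.zero_rpow ha.ne', sub_zero]
    field_simp
  have hi : IntegrableOn (fun l : ℝ => a * l ^ (a - 1) * Real.exp (-(2 * t))) (Set.Ioc 0 t) := by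
    have := intervalIntegral.intervalIntegrable_rpow' (a := 0) (b := t)
      (show -1 < a - 1 by linarith)
    rw [intervalIntegrable_iff_integrableOn_Ioc_of_le ht.le] at this
    exact (this.const_mul a).mul_const _
  rw [← hI, ofReal_integral_eq_lintegral_ofReal hi
    ((ae_restrict_iff' measurableSet_Ioc).2 (ae_of_all _ fun l hl => by
      have := hl.1.le
      positivity))]
  exact setLIntegral_mono' measurableSet_Ioc fun l hl => le_gammaPDF ha ha1 hξ hl.1.le hl.2

theorem le_setLIntegral_Icc_doubleExpPDF {δ₀ δ₁ δ c M w : ℝ} (hδ₀ : 0 < δ₀) (h₀ : δ₀ ≤ δ)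
    (h₁ : δ ≤ δ₁) (hc : |c| ≤ M) :
    ENNReal.ofReal (w / δ₁ * Real.exp (-((M + w) / δ₀)))
      ≤ ∫⁻ x in Set.Icc (c - w) (c + w), doubleExpPDF δ x := by
  have hδ := hδ₀.trans_le h₀
  have hδ₁ := hδ.trans_le h₁
  have h : ∀ x ∈ Set.Icc (c - w) (c + w),
      ENNReal.ofReal ((2 * δ₁)⁻¹ * Real.exp (-((M + w) / δ₀))) ≤ doubleExpPDF δ x := by
    intro x hx
    have hx' : |x| ≤ M + w := by
      rw [abs_le] at hc ⊢
      constructor <;> linarith [hx.1, hx.2]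
    have hMw : 0 ≤ M + w := (abs_nonneg x).trans hx'
    refine ENNReal.ofReal_le_ofReal ?_
    gcongr
  calc _ = ∫⁻ _ in Set.Icc (c - w) (c + w),
        ENNReal.ofReal ((2 * δ₁)⁻¹ * Real.exp (-((M + w) / δ₀))) := by
        rw [setLIntegral_const, Real.volume_Icc, ← ENNReal.ofReal_mul (by positivity)]
        congr 1
        field_simp
        ring
    _ ≤ _ := setLIntegral_mono' measurableSet_Icc h

/-- Given the global scale, a coefficient lies close to `0` with probability bounded below. -/
theorem le_lintegral_gammaPDF_mul_zero {σ a ξ w : ℝ} (hσ : 0 < σ) (ha : 0 < a) (ha1 : a ≤ 1)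
    (hξ : ξ ∈ Set.Icc (1 : ℝ) 2) (hw : 0 < w) :
    ENNReal.ofReal ((2 * w ^ 2 / σ ^ 2) ^ a * Real.exp (-(2 * (2 * w ^ 2 / σ ^ 2))) * Real.exp (-1))
      ≤ ∫⁻ l, gammaPDF a ξ l *
        ∫⁻ x in Set.Icc (0 - w) (0 + w), doubleExpPDF (σ * √(l / 2)) x := by
  -- For `l ≥ 0`, `l ≤ t` means exactly that the double-exponential scale `σ √(l / 2)` is at most
  -- `w`.
  set t := 2 * w ^ 2 / σ ^ 2 with ht
  have ht0 : 0 < t := by positivity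
  rw [ENNReal.ofReal_mul (by positivity)]
  calc _ ≤ (∫⁻ l in Set.Ioc 0 t, gammaPDF a ξ l) * ENNReal.ofReal (Real.exp (-1)) := by
        gcongr
        exact le_setLIntegral_Ioc_gammaPDF ha ha1 hξ ht0
    _ = ∫⁻ l in Set.Ioc 0 t, gammaPDF a ξ l * ENNReal.ofReal (Real.exp (-1)) :=
        (lintegral_mul_const' _ _ ENNReal.ofReal_ne_top).symm
    _ ≤ ∫⁻ l in Set.Ioc 0 t, gammaPDF a ξ l *
        ∫⁻ x in Set.Icc (0 - w) (0 + w), doubleExpPDF (σ * √(l / 2)) x := by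
        refine setLIntegral_mono' measurableSet_Ioc fun l hl => ?_
        gcongr
        set δ := σ * √(l / 2) with hδ
        have hl0 := hl.1
        have hδ0 : 0 < δ := by positivity
        have hδw : δ ≤ w := by
          have h2 : l / 2 ≤ (w / σ) ^ 2 := by
            have := hl.2
            rw [ht] at this
            rw [div_pow]
            linarith [mul_div_assoc 2 (w ^ 2) (σ ^ 2)]
          have h3 := Real.sqrt_le_sqrt h2
          rw [Real.sqrt_sq (by positivity), le_div_iff₀ hσ] at h3
          linarith
        -- Within one scale of its centre the distribution has mass at least `exp (-1)`.
        have h4 := le_setLIntegral_Icc_doubleExpPDF (c := 0) (M := 0) (w := δ) hδ0 le_rfl le_rfl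
          (by simp)
        rw [zero_add, div_self hδ0.ne', one_mul] at h4
        exact h4.trans (lintegral_mono_set (Set.Icc_subset_Icc (by linarith) (by linarith)))
    _ ≤ _ := setLIntegral_le_lintegral _ _

/-- Given the global scale, a coefficient lies close to a bounded value with probability at least
of the order of the shape parameter times the width. -/
theorem le_lintegral_gammaPDF_mul_of_abs_le {σ a ξ c M w : ℝ} (hσ : 0 < σ) (ha : 0 < a)
    (ha1 : a ≤ 1) (hξ : ξ ∈ Set.Icc (1 : ℝ) 2) (hc : |c| ≤ M) :
    ENNReal.ofReal (a * (1 / 2) * Real.exp (-4) * (w / σ * Real.exp (-((M + w) / (σ / 2)))))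
      ≤ ∫⁻ l, gammaPDF a ξ l *
        ∫⁻ x in Set.Icc (c - w) (c + w), doubleExpPDF (σ * √(l / 2)) x := by
  -- Only `l ∈ [1, 2]` is kept, where the scale `σ √(l / 2)` lies in `[σ / 2, σ]`.
  calc _ = ∫⁻ _ in Set.Icc (1 : ℝ) 2, ENNReal.ofReal
        (a * (1 / 2) * Real.exp (-4) * (w / σ * Real.exp (-((M + w) / (σ / 2))))) := by
        rw [setLIntegral_const, Real.volume_Icc]
        norm_num
    _ ≤ ∫⁻ l in Set.Icc (1 : ℝ) 2, gammaPDF a ξ l *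
        ∫⁻ x in Set.Icc (c - w) (c + w), doubleExpPDF (σ * √(l / 2)) x := by
        refine setLIntegral_mono' measurableSet_Icc fun l hl => ?_
        rw [ENNReal.ofReal_mul (by positivity)]
        have hl0 : 0 < l := one_pos.trans_le hl.1
        refine mul_le_mul' ?_ ?_
        · refine le_trans (ENNReal.ofReal_le_ofReal ?_) (le_gammaPDF ha ha1 hξ hl0.le hl.2)
          have : (1 / 2 : ℝ) ≤ l ^ (a - 1) := by
            calc (1 / 2 : ℝ) = 2 ^ (-1 : ℝ) := by rw [Real.rpow_neg_one]; norm_num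
              _ ≤ 2 ^ (a - 1) := Real.rpow_le_rpow_of_exponent_le (by norm_num) (by linarith)
              _ ≤ l ^ (a - 1) := Real.rpow_le_rpow_of_nonpos hl0 hl.2 (by linarith)
          norm_num
          gcongr
        · refine le_setLIntegral_Icc_doubleExpPDF (by positivity) ?_ ?_ hc
          · have : (1 / 2 : ℝ) ≤ √(l / 2) := Real.le_sqrt_of_sq_le (by linarith [hl.1])
            nlinarith
          · have : √(l / 2) ≤ 1 := Real.sqrt_le_one.2 (by linarith [hl.2])
            nlinarith
    _ ≤ _ := setLIntegral_le_lintegral _ _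

theorem exists_exp_le_setLIntegral_gammaPDF {b : ℝ} (hb : 0 < b) :
    ∃ g : ℝ, ENNReal.ofReal (Real.exp (-g)) ≤ ∫⁻ ξ in Set.Icc (1 : ℝ) 2, gammaPDF b 1 ξ := by
  set G := ∫⁻ ξ in Set.Icc (1 : ℝ) 2, gammaPDF b 1 ξ
  have hG0 : 0 < G := by
    refine (setLIntegral_pos_iff (f := gammaPDF b 1)
      (measurable_gammaPDFReal b 1).ennreal_ofReal).2 ?_
    have : Set.Icc (1 : ℝ) 2 ⊆ Function.support (gammaPDF b 1) ∩ Set.Icc 1 2 := fun x hx =>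
      ⟨by simp [gammaPDF, gammaPDFReal_pos hb one_pos (one_pos.trans_le hx.1)], hx⟩
    exact lt_of_lt_of_le (by simp [Real.volume_Icc]) (measure_mono this)
  have hG1 : G ≠ ⊤ := ((setLIntegral_le_lintegral _ _).trans_lt
    (by rw [lintegral_gammaPDF_eq_one hb one_pos]; exact ENNReal.one_lt_top)).ne
  refine ⟨-Real.log G.toReal, ?_⟩
  rw [neg_neg, Real.exp_log (ENNReal.toReal_pos hG0.ne' hG1), ENNReal.ofReal_toReal hG1]

theorem le_r2d2Prior_box {p : ℕ} {σ a b w M K K' : ℝ} (hσ : 0 < σ) (ha : 0 < a) (ha1 : a ≤ 1)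
    (hw : 0 < w) (β₀ : Fin p → ℝ) (hM : ∀ j, |β₀ j| ≤ M) (hK : 0 ≤ K)
    (hz : Real.exp (-K) ≤
      (2 * w ^ 2 / σ ^ 2) ^ a * Real.exp (-(2 * (2 * w ^ 2 / σ ^ 2))) * Real.exp (-1))
    (hnz : Real.exp (-K') ≤
      a * (1 / 2) * Real.exp (-4) * (w / σ * Real.exp (-((M + w) / (σ / 2))))) :
    (∫⁻ ξ in Set.Icc (1 : ℝ) 2, gammaPDF b 1 ξ) *
      ENNReal.ofReal (Real.exp (-(K * p + K' * Nat.card {j // β₀ j ≠ 0})))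
      ≤ r2d2Prior p σ a b {β | ∀ j, β j ∈ Set.Icc (β₀ j - w) (β₀ j + w)} := by
  classical
  rw [r2d2Prior_box p σ a b _ fun _ => measurableSet_Icc,
    ← lintegral_mul_const' _ _ ENNReal.ofReal_ne_top]
  refine le_trans (setLIntegral_mono' measurableSet_Icc fun ξ hξ => ?_)
    (setLIntegral_le_lintegral (Set.Icc (1 : ℝ) 2) _)
  gcongr
  -- Every coordinate is charged `K`, and the nonzero ones `K'` in addition.
  have hsum : -(K * p + K' * Nat.card {j // β₀ j ≠ 0})
      = ∑ j, -(K + if β₀ j ≠ 0 then K' else 0) := by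
    rw [Finset.sum_neg_distrib, Finset.sum_add_distrib, ← Finset.sum_filter]
    simp [Nat.card_eq_fintype_card, Fintype.card_subtype, mul_comm]
  rw [hsum, Real.exp_sum, ENNReal.ofReal_prod_of_nonneg fun i _ => (Real.exp_pos _).le]
  refine Finset.prod_le_prod' fun j _ => ?_
  by_cases h : β₀ j = 0
  · rw [h]
    refine le_trans (ENNReal.ofReal_le_ofReal ?_) (le_lintegral_gammaPDF_mul_zero hσ ha ha1 hξ hw)
    simpa using hz
  · refine le_trans (ENNReal.ofReal_le_ofReal ?_)
      (le_lintegral_gammaPDF_mul_of_abs_le hσ ha ha1 hξ (hM j))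
    refine le_trans (Real.exp_le_exp.2 ?_) hnz
    simp [h, hK]

/-- Bounds on the shape parameter `C / (p ^ (b / 2) * n ^ (ρ * b / 2) * log n)`. -/
theorem shape_bounds {p n : ℕ} {b ρ C a : ℝ} (hp : 0 < p) (hpn : p ≤ n) (hn : 1 ≤ Real.log n)
    (hb : 0 < b) (hρ : 0 < ρ) (hC : 0 < C)
    (ha : a = C / ((p : ℝ) ^ (b / 2) * (n : ℝ) ^ (ρ * b / 2) * Real.log n)) :
    0 < a ∧ a * Real.log n ≤ C ∧
      -|Real.log C| - (b / 2 + ρ * b / 2 + 1) * Real.log n ≤ Real.log a := by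
  have hp1 : (1 : ℝ) ≤ p := by exact_mod_cast hp
  have hpn' : (p : ℝ) ≤ n := by exact_mod_cast hpn
  have hn1 : (1 : ℝ) ≤ n := hp1.trans hpn'
  have hl : 0 < Real.log n := by linarith
  have h1 : 1 ≤ (p : ℝ) ^ (b / 2) := Real.one_le_rpow hp1 (by positivity)
  have h2 : 1 ≤ (n : ℝ) ^ (ρ * b / 2) := Real.one_le_rpow hn1 (by positivity)
  refine ⟨by rw [ha]; positivity, ?_, ?_⟩
  · rw [ha, div_mul_eq_mul_div, mul_div_mul_right _ _ hl.ne']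
    exact div_le_self hC.le (one_le_mul_of_one_le_of_one_le h1 h2)
  · rw [ha, Real.log_div hC.ne' (by positivity), Real.log_mul (by positivity) hl.ne',
      Real.log_mul (by positivity) (by positivity), Real.log_rpow (by linarith),
      Real.log_rpow (by linarith)]
    have h3 : Real.log (Real.log n) ≤ Real.log n := (Real.log_le_sub_one_of_pos hl).trans
      (by linarith)
    have h4 : Real.log p ≤ Real.log n := Real.log_le_log (by linarith) hpn'
    have h5 : b / 2 * Real.log p ≤ b / 2 * Real.log n := by gcongr
    have := neg_abs_le (Real.log C)
    linarith

theorem eventually_exp_le_r2d2Prior_box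
    (p : ℕ → ℕ) (hp_pos : ∀ n, 0 < p n) (β₀ : (n : ℕ) → Fin (p n) → ℝ)
    {σ : ℝ} (hσ : 0 < σ) (hp : (fun n : ℕ => (p n : ℝ)) =o[atTop] (fun n : ℕ => (n : ℝ)))
    {M : ℝ} (hM0 : 0 ≤ M) (hM : ∀ᶠ n in atTop, ∀ j, |β₀ n j| ≤ M)
    (hq : (fun n : ℕ => (Nat.card {j // β₀ n j ≠ 0} : ℝ)) =o[atTop]
      (fun n : ℕ => (n : ℝ) / Real.log n))
    {b ρ C : ℝ} (hb : 0 < b) (hρ : 0 < ρ) (hC : 0 < C) (aπ : ℕ → ℝ)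
    (haπ : ∀ n : ℕ, aπ n = C / ((p n : ℝ) ^ (b / 2) * (n : ℝ) ^ (ρ * b / 2) * Real.log n))
    {κ r : ℝ} (hκ : 0 < κ) (hr : 0 < r) :
    ∀ᶠ n : ℕ in atTop, ENNReal.ofReal (Real.exp (-(κ * n))) ≤ r2d2Prior (p n) σ (aπ n) b
      {β | ∀ j, β j ∈ Set.Icc (β₀ n j - r / √(p n)) (β₀ n j + r / √(p n))} := by
  obtain ⟨g, hg⟩ := exists_exp_le_setLIntegral_gammaPDF hb
  set L : ℝ := 2 * r ^ 2 / σ ^ 2 with hL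
  have hL0 : 0 < L := by positivity
  set K : ℝ := |Real.log L| + C + 2 * L + 1 with hK
  have hK0 : 0 < K := by positivity
  set D : ℝ := |Real.log C| + Real.log 2 + 4 + |Real.log r| + |Real.log σ| + (M + r) / (σ / 2)
    with hD
  have hlog2 : 0 < Real.log 2 := Real.log_pos (by norm_num)
  have hD0 : 0 < D := by positivity
  -- The `3 / 2` is `1` from the lower bound on `log a` plus `1 / 2` from `log √p` in `log w`.
  set E : ℝ := D + (b / 2 + ρ * b / 2 + 3 / 2) with hE
  have hE0 : 0 < E := by positivity
  have hlogn : Tendsto (fun n : ℕ => Real.log n) atTop atTop :=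
    Real.tendsto_log_atTop.comp tendsto_natCast_atTop_atTop
  -- The budget `κ n` is split in thirds: all coordinates, the surcharge for nonzero ones, and the
  -- restriction of `ξ`.
  filter_upwards [hM, hp.bound one_pos, hp.bound (show 0 < κ / (3 * K) by positivity),
    hq.bound (show 0 < κ / (3 * E) by positivity), hlogn.eventually_ge_atTop 1,
    hlogn.eventually_ge_atTop C, (tendsto_natCast_atTop_atTop (R := ℝ)).eventually_ge_atTop
      (3 * g / κ)] with n hMn hpn hpK hqE hn1 hnC hng
  have hln : 0 < Real.log n := by linarith
  rw [Real.norm_natCast, Real.norm_natCast] at hpn hpK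
  rw [Real.norm_natCast, norm_div, Real.norm_natCast, Real.norm_of_nonneg hln.le] at hqE
  have hpn' : p n ≤ n := by rw [one_mul] at hpn; exact_mod_cast hpn
  obtain ⟨ha, haC, hlog⟩ := shape_bounds (hp_pos n) hpn' hn1 hb hρ hC (haπ n)
  have ha1 : aπ n ≤ 1 := by
    by_contra! h
    nlinarith
  have hp1 : (1 : ℝ) ≤ p n := by exact_mod_cast hp_pos n
  have hp0 : (0 : ℝ) < p n := by linarith
  have hlogp : Real.log (p n) ≤ Real.log n := Real.log_le_log hp0 (by linarith)
  have hlogp0 : 0 ≤ Real.log (p n) := Real.log_nonneg hp1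
  set w := r / √(p n) with hw
  have hw0 : 0 < w := by positivity
  have hwr : w ≤ r := div_le_self hr.le (Real.one_le_sqrt.2 hp1)
  have hw2 : 2 * w ^ 2 / σ ^ 2 = L / p n := by
    rw [hw, hL, div_pow, Real.sq_sqrt hp0.le]
    field_simp
  have hz : Real.exp (-K) ≤
      (2 * w ^ 2 / σ ^ 2) ^ aπ n * Real.exp (-(2 * (2 * w ^ 2 / σ ^ 2))) * Real.exp (-1) := by
    rw [hw2, Real.rpow_def_of_pos (by positivity), ← Real.exp_add, ← Real.exp_add,
      Real.exp_le_exp, Real.log_div hL0.ne' hp0.ne']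
    have h1 : L / p n ≤ L := div_le_self hL0.le hp1
    have h2 : Real.log (p n) * aπ n ≤ C := by
      calc _ ≤ Real.log n * aπ n := by gcongr
        _ ≤ C := by linarith
    have h3 : -|Real.log L| ≤ Real.log L * aπ n := by
      have := neg_abs_le (Real.log L)
      have h4 := abs_nonneg (Real.log L)
      nlinarith
    rw [sub_mul]
    linarith
  have hnz : Real.exp (-(E * Real.log n)) ≤
      aπ n * (1 / 2) * Real.exp (-4) * (w / σ * Real.exp (-((M + w) / (σ / 2)))) := by
    rw [← Real.le_log_iff_exp_le (by positivity), Real.log_mul (by positivity) (by positivity),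
      Real.log_mul (by positivity) (by positivity), Real.log_mul (by positivity) (by positivity),
      Real.log_mul (by positivity) (by positivity), Real.log_exp, Real.log_exp,
      Real.log_div hw0.ne' hσ.ne', hw, Real.log_div hr.ne' (by positivity), ← hw,
      Real.log_sqrt hp0.le, one_div, Real.log_inv]
    have h1 : (M + w) / (σ / 2) ≤ (M + r) / (σ / 2) := by gcongr
    have h2 := neg_abs_le (Real.log r)
    have h3 := le_abs_self (Real.log σ)
    have h4 : D ≤ D * Real.log n := le_mul_of_one_le_right hD0.le hn1
    rw [hE, add_mul]
    linarith
  have key := le_r2d2Prior_box (b := b) hσ ha ha1 hw0 (β₀ n) hMn hK0.le hz hnz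
  refine le_trans ?_ ((mul_le_mul_left hg _).trans key)
  rw [← ENNReal.ofReal_mul (Real.exp_pos _).le, ← Real.exp_add]
  refine ENNReal.ofReal_le_ofReal (Real.exp_le_exp.2 ?_)
  have e1 : K * p n ≤ κ * n / 3 := by
    calc K * p n ≤ K * (κ / (3 * K) * n) := by gcongr
      _ = κ * n / 3 := by field_simp
  have e2 : E * Real.log n * (Nat.card {j // β₀ n j ≠ 0}) ≤ κ * n / 3 := by
    calc _ ≤ E * Real.log n * (κ / (3 * E) * (n / Real.log n)) := by gcongr
      _ = κ * n / 3 := by field_simp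
  have e3 : g ≤ κ * n / 3 := by
    rw [div_le_iff₀ hκ] at hng
    linarith
  linarith

/-! ### Likelihood ratio and the deterministic posterior bound -/

theorem gaussianPDF_add_eq_mul (μ d x : ℝ) {σ : ℝ} (hσ : 0 < σ) :
    gaussianPDF (μ + d) (σ ^ 2).toNNReal x = gaussianPDF μ (σ ^ 2).toNNReal x *
      ENNReal.ofReal (Real.exp ((2 * ((x - μ) * d) - d * d) / (2 * σ ^ 2))) := by
  simp only [gaussianPDF]
  rw [← ENNReal.ofReal_mul (gaussianPDFReal_nonneg _ _ _)]
  simp only [gaussianPDFReal, Real.coe_toNNReal _ (sq_nonneg σ)]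
  rw [mul_assoc _ (Real.exp _), ← Real.exp_add]
  congr 3
  field_simp
  ring

theorem linearModelLikelihood_eq_mul {n p : ℕ} (X : Matrix (Fin n) (Fin p) ℝ) {σ : ℝ}
    (hσ : 0 < σ) (e : Fin n → ℝ) (β₀ h : Fin p → ℝ) :
    linearModelLikelihood X σ (X *ᵥ β₀ + e) (β₀ + h) =
      linearModelLikelihood X σ (X *ᵥ β₀ + e) β₀ * ENNReal.ofReal
        (Real.exp ((2 * ((Xᵀ *ᵥ e) ⬝ᵥ h) - (X *ᵥ h) ⬝ᵥ (X *ᵥ h)) / (2 * σ ^ 2))) := by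
  have h1 : (Xᵀ *ᵥ e) ⬝ᵥ h = e ⬝ᵥ (X *ᵥ h) := by
    rw [Matrix.dotProduct_mulVec, Matrix.mulVec_transpose]
  have h2 : Real.exp ((2 * ((Xᵀ *ᵥ e) ⬝ᵥ h) - (X *ᵥ h) ⬝ᵥ (X *ᵥ h)) / (2 * σ ^ 2))
      = ∏ i, Real.exp ((2 * (e i * (X *ᵥ h) i) - (X *ᵥ h) i * (X *ᵥ h) i) / (2 * σ ^ 2)) := by
    rw [← Real.exp_sum, ← Finset.sum_div, Finset.sum_sub_distrib, ← Finset.mul_sum, h1]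
    rfl
  rw [h2, ENNReal.ofReal_prod_of_nonneg fun i _ => (Real.exp_pos _).le, linearModelLikelihood,
    linearModelLikelihood, ← Finset.prod_mul_distrib]
  refine Finset.prod_congr rfl fun i _ => ?_
  rw [Matrix.mulVec_add, Pi.add_apply, gaussianPDF_add_eq_mul _ _ _ hσ]
  simp

theorem norm_toLp_sq_eq_dotProduct {p : ℕ} (h : Fin p → ℝ) :
    ‖WithLp.toLp 2 h‖ ^ 2 = h ⬝ᵥ h := by
  rw [EuclideanSpace.real_norm_sq_eq]
  simp [dotProduct, sq]

theorem abs_dotProduct_le_mul_norm {p : ℕ} {u : Fin p → ℝ} {t : ℝ} (ht : 0 ≤ t)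
    (hu : u ⬝ᵥ u ≤ t ^ 2) (h : Fin p → ℝ) : |u ⬝ᵥ h| ≤ t * ‖WithLp.toLp 2 h‖ := by
  refine abs_le_of_sq_le_sq ?_ (by positivity)
  rw [mul_pow, norm_toLp_sq_eq_dotProduct]
  calc (u ⬝ᵥ h) ^ 2 ≤ (u ⬝ᵥ u) * (h ⬝ᵥ h) := by
        simpa only [dotProduct, sq] using Finset.sum_mul_sq_le_sq_mul_sq Finset.univ u h
    _ ≤ t ^ 2 * (h ⬝ᵥ h) := by
        have : 0 ≤ h ⬝ᵥ h := by rw [← norm_toLp_sq_eq_dotProduct]; positivity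
        gcongr

theorem norm_toLp_le_of_abs_le {p : ℕ} {h : Fin p → ℝ} {r : ℝ} (hr : 0 ≤ r) (hp : 0 < p)
    (hh : ∀ j, |h j| ≤ r / √p) : ‖WithLp.toLp 2 h‖ ≤ r := by
  refine abs_le_of_sq_le_sq' ?_ hr |>.2
  rw [norm_toLp_sq_eq_dotProduct]
  have hp' : (0 : ℝ) < p := by exact_mod_cast hp
  calc h ⬝ᵥ h ≤ ∑ _j : Fin p, r ^ 2 / p := by
        refine Finset.sum_le_sum fun j _ => ?_
        have := sq_le_sq' (by linarith [hh j, neg_abs_le (h j), abs_nonneg (h j)]) (hh j)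
        rw [sq_abs, div_pow, Real.sq_sqrt hp'.le] at this
        linarith [sq (h j)]
    _ = r ^ 2 := by simp; field_simp

/-- Deterministic bound for the posterior probability of the complement of a ball, when the
score `Xᵀ e` at the true coefficient vector is small. -/
theorem posteriorProb_le {n p : ℕ} (X : Matrix (Fin n) (Fin p) ℝ) {σ : ℝ} (hσ : 0 < σ)
    (μ : Measure (Fin p → ℝ)) (hμ : μ Set.univ ≤ 1) (e : Fin n → ℝ) (β₀ : Fin p → ℝ)
    {dmin dmax ε r : ℝ} (hd : 0 < dmin) (hε : 0 < ε) (hr : r ≤ ε / 8)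
    (hr2 : dmax * r ^ 2 ≤ dmin * ε ^ 2 / 16) (hdmax : 0 ≤ dmax)
    (hX1 : ∀ h : Fin p → ℝ, n * dmin * (h ⬝ᵥ h) ≤ (X *ᵥ h) ⬝ᵥ (X *ᵥ h))
    (hX2 : ∀ h : Fin p → ℝ, (X *ᵥ h) ⬝ᵥ (X *ᵥ h) ≤ n * dmax * (h ⬝ᵥ h))
    (he : (Xᵀ *ᵥ e) ⬝ᵥ (Xᵀ *ᵥ e) ≤ (dmin * ε / 4 * n) ^ 2)
    (T : Set (Fin p → ℝ)) (hT : MeasurableSet T) (hTr : ∀ β ∈ T, ‖WithLp.toLp 2 (β - β₀)‖ ≤ r)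
    (hTμ : ENNReal.ofReal (Real.exp (-(dmin * ε ^ 2 / (16 * σ ^ 2) * n))) ≤ μ T) :
    posteriorProb X σ μ (X *ᵥ β₀ + e) {β | ε < ‖WithLp.toLp 2 (β - β₀)‖}
      ≤ ENNReal.ofReal (Real.exp (-(dmin * ε ^ 2 / (8 * σ ^ 2) * n))) := by
  set ℓ := linearModelLikelihood X σ (X *ᵥ β₀ + e) with hℓ
  have hn : (0 : ℝ) ≤ n := Nat.cast_nonneg n
  have hlik : ∀ β, ℓ β = ℓ β₀ * ENNReal.ofReal (Real.exp ((2 * ((Xᵀ *ᵥ e) ⬝ᵥ (β - β₀)) -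
      (X *ᵥ (β - β₀)) ⬝ᵥ (X *ᵥ (β - β₀))) / (2 * σ ^ 2))) := fun β => by
    have := linearModelLikelihood_eq_mul X hσ e β₀ (β - β₀)
    rwa [add_sub_cancel] at this
  have hcs := abs_dotProduct_le_mul_norm (by positivity) he
  have hSmeas : MeasurableSet {β : Fin p → ℝ | ε < ‖WithLp.toLp 2 (β - β₀)‖} :=
    (isOpen_lt continuous_const ((PiLp.continuous_toLp 2 _).comp
      (continuous_id.sub continuous_const)).norm).measurableSet
  -- For `|h| = s > ε` the score term is at most `n dmin ε s / 2`, hence at most half of the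
  -- quadratic term.
  have hnum : ∫⁻ β in {β | ε < ‖WithLp.toLp 2 (β - β₀)‖}, ℓ β ∂μ
      ≤ ℓ β₀ * ENNReal.ofReal (Real.exp (-(dmin * ε ^ 2 / (4 * σ ^ 2) * n))) := by
    calc _ ≤ ∫⁻ _ in {β | ε < ‖WithLp.toLp 2 (β - β₀)‖},
          ℓ β₀ * ENNReal.ofReal (Real.exp (-(dmin * ε ^ 2 / (4 * σ ^ 2) * n))) ∂μ := by
          refine setLIntegral_mono' hSmeas fun β hβ => ?_
          rw [hlik β]
          gcongr
          have h1 := (le_abs_self _).trans (hcs (β - β₀))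
          have h2 := hX1 (β - β₀)
          rw [← norm_toLp_sq_eq_dotProduct (β - β₀)] at h2
          set s := ‖WithLp.toLp 2 (β - β₀)‖
          have hs : ε < s := hβ
          have h3 : n * dmin * (ε * s) ≤ n * dmin * s ^ 2 := by
            rw [sq]; gcongr
          have h4 : n * dmin * ε ^ 2 ≤ n * dmin * s ^ 2 := by gcongr
          rw [div_le_iff₀ (by positivity)]
          have h5 : -(dmin * ε ^ 2 / (4 * σ ^ 2) * n) * (2 * σ ^ 2) = -(n * dmin * ε ^ 2 / 2) := by
            field_simp
            ring
          rw [h5]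
          linarith
      _ ≤ _ := by
          rw [setLIntegral_const]
          exact mul_le_of_le_one_right' ((measure_mono (Set.subset_univ _)).trans hμ)
  -- On `T` the score and quadratic terms each cost at most `n dmin ε² / 16`. One exponential is the
  -- resulting likelihood ratio, the other the prior mass of `T`.
  have hden : ℓ β₀ * ENNReal.ofReal (Real.exp (-(dmin * ε ^ 2 / (16 * σ ^ 2) * n))) *
      ENNReal.ofReal (Real.exp (-(dmin * ε ^ 2 / (16 * σ ^ 2) * n))) ≤ ∫⁻ β, ℓ β ∂μ := by
    calc _ ≤ ∫⁻ _ in T,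
          ℓ β₀ * ENNReal.ofReal (Real.exp (-(dmin * ε ^ 2 / (16 * σ ^ 2) * n))) ∂μ := by
          rw [setLIntegral_const]
          gcongr
      _ ≤ ∫⁻ β in T, ℓ β ∂μ := by
          refine setLIntegral_mono' hT fun β hβ => ?_
          rw [hlik β]
          gcongr
          have h1 := (abs_le.1 (hcs (β - β₀))).1
          have h2 := hX2 (β - β₀)
          rw [← norm_toLp_sq_eq_dotProduct (β - β₀)] at h2
          have hs := hTr β hβ
          have hs0 := norm_nonneg (WithLp.toLp 2 (β - β₀))
          set s := ‖WithLp.toLp 2 (β - β₀)‖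
          have h3 : n * (dmax * s ^ 2) ≤ n * (dmin * ε ^ 2 / 16) := by
            refine mul_le_mul_of_nonneg_left (le_trans ?_ hr2) hn
            gcongr
          have h4 : dmin * ε / 4 * n * s ≤ dmin * ε / 4 * n * (ε / 8) := by
            gcongr
            exact hs.trans hr
          rw [le_div_iff₀ (by positivity)]
          have h5 : -(dmin * ε ^ 2 / (16 * σ ^ 2) * n) * (2 * σ ^ 2)
              = -(n * (dmin * ε ^ 2 / 8)) := by
            field_simp
            ring
          rw [h5]
          linarith
      _ ≤ _ := setLIntegral_le_lintegral _ _
  -- In units of `dmin ε² n / σ²`, the rates balance as `1/4 = 1/8 + 1/16 + 1/16`.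
  refine ENNReal.div_le_of_le_mul (hnum.trans (le_trans (le_of_eq ?_)
    (mul_le_mul_right hden _)))
  rw [mul_assoc, mul_left_comm, ← ENNReal.ofReal_mul (Real.exp_pos _).le,
    ← ENNReal.ofReal_mul (Real.exp_pos _).le, ← Real.exp_add, ← Real.exp_add]
  congr 3
  field_simp
  ring

/-! ### Eigenvalue bounds and conclusion -/

theorem le_dotProduct_self_mulVec {n p : ℕ} {X : Matrix (Fin n) (Fin p) ℝ} {d : ℝ} (hn : 0 < n)
    (hd : (d : EReal) < minEigenvalue X) (h : Fin p → ℝ) :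
    n * d * (h ⬝ᵥ h) ≤ (X *ᵥ h) ⬝ᵥ (X *ᵥ h) := by
  obtain ⟨w, hw, hq⟩ := dotProduct_mulVec_eq_sum_eigenvalues (scaledGram_isHermitian X) h
  rw [dotProduct_self_mulVec_eq X hn, hq, ← hw, mul_assoc, dotProduct, Finset.mul_sum _ _ d]
  refine mul_le_mul_of_nonneg_left (Finset.sum_le_sum fun j _ => ?_) (Nat.cast_nonneg n)
  have : d ≤ (scaledGram_isHermitian X).eigenvalues j := by
    exact_mod_cast hd.le.trans (iInf_le _ j)
  rw [← sq]
  gcongr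

theorem dotProduct_self_mulVec_le {n p : ℕ} {X : Matrix (Fin n) (Fin p) ℝ} {d : ℝ} (hn : 0 < n)
    (hd : maxEigenvalue X < (d : EReal)) (h : Fin p → ℝ) :
    (X *ᵥ h) ⬝ᵥ (X *ᵥ h) ≤ n * d * (h ⬝ᵥ h) := by
  obtain ⟨w, hw, hq⟩ := dotProduct_mulVec_eq_sum_eigenvalues (scaledGram_isHermitian X) h
  rw [dotProduct_self_mulVec_eq X hn, hq, ← hw, mul_assoc, dotProduct, Finset.mul_sum _ _ d]
  refine mul_le_mul_of_nonneg_left (Finset.sum_le_sum fun j _ => ?_) (Nat.cast_nonneg n)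
  have : (scaledGram_isHermitian X).eigenvalues j ≤ d := by
    exact_mod_cast (le_iSup (fun j => ((scaledGram_isHermitian X).eigenvalues j : EReal)) j).trans
      hd.le
  rw [← sq]
  gcongr

/-- Random variables that are exponentially small off events of exponentially small probability
converge to zero in probability and almost surely. -/
theorem tendsto_zero_of_exp_small {Ω : Type*} [MeasurableSpace Ω] {P : Measure Ω}
    (F : ℕ → Ω → ℝ≥0∞) (A : ℕ → Set Ω) {c d : ℝ} (hc : 0 < c) (hd : 0 < d)
    (hA : ∀ᶠ n : ℕ in atTop, P (A n) ≤ ENNReal.ofReal (Real.exp (-(c * n))))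
    (hF : ∀ᶠ n : ℕ in atTop, ∀ ω ∉ A n, F n ω ≤ ENNReal.ofReal (Real.exp (-(d * n)))) :
    (∀ δ : ℝ≥0∞, 0 < δ → Tendsto (fun n => P {ω | δ < F n ω}) atTop (𝓝 0)) ∧
      ∀ᵐ ω ∂P, Tendsto (fun n => F n ω) atTop (𝓝 0) := by
  have hexp : ∀ {k : ℝ}, 0 < k →
      Tendsto (fun n : ℕ => ENNReal.ofReal (Real.exp (-(k * n)))) atTop (𝓝 0) := fun {k} hk => by
    rw [← ENNReal.ofReal_zero]
    refine ENNReal.tendsto_ofReal (Real.tendsto_exp_neg_atTop_nhds_zero.comp ?_)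
    exact tendsto_natCast_atTop_atTop.const_mul_atTop hk
  constructor
  · intro δ hδ
    refine tendsto_of_tendsto_of_tendsto_of_le_of_le' tendsto_const_nhds (hexp hc)
      (Eventually.of_forall fun _ => zero_le) ?_
    filter_upwards [hA, hF, (hexp hd).eventually_lt_const hδ] with n h1 h2 h3
    refine (measure_mono fun ω hω => ?_).trans h1
    by_contra hω'
    exact absurd ((h2 ω hω').trans_lt h3) (not_lt.2 (le_of_lt hω))
  · obtain ⟨N, hN⟩ := eventually_atTop.1 hA
    -- Only the first Borel–Cantelli lemma is used, so no joint law across different `n` is needed.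
    have hsum : ∑' n, P (A (n + N)) ≠ ⊤ := by
      have hs : Summable fun n : ℕ => Real.exp (-(c * (n + N : ℕ))) := by
        have := (summable_nat_add_iff N).2 (Real.summable_exp_nat_mul_iff.2 (neg_lt_zero.2 hc))
        refine this.congr fun n => ?_
        congr 1
        ring
      refine ne_top_of_le_ne_top hs.tsum_ofReal_ne_top (ENNReal.tsum_le_tsum fun n => ?_)
      exact hN _ (Nat.le_add_left N n)
    filter_upwards [ae_eventually_notMem hsum] with ω hω
    have hω' : ∀ᶠ n in atTop, ω ∉ A n := by
      rw [← map_add_atTop_eq_nat N]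
      exact hω
    refine tendsto_of_tendsto_of_tendsto_of_le_of_le' tendsto_const_nhds (hexp hd)
      (Eventually.of_forall fun _ => zero_le) ?_
    filter_upwards [hω', hF] with n h1 h2 using h2 ω h1

theorem mainTheorem1
    -- dimensions, design matrices, true coefficient vectors, error standard deviation
    (p : ℕ → ℕ) (hp_pos : ∀ n, 0 < p n)
    (X : (n : ℕ) → Matrix (Fin n) (Fin (p n)) ℝ)
    (β₀ : (n : ℕ) → Fin (p n) → ℝ)
    (σ : ℝ) (hσ : 0 < σ)
    -- (A1)
    (hp : (fun n : ℕ => (p n : ℝ)) =o[atTop] (fun n : ℕ => (n : ℝ)))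
    -- (A2)
    (dmin dmax : ℝ) (hdmin : 0 < dmin)
    (hmin : (dmin : EReal) < liminf (fun n => minEigenvalue (X n)) atTop)
    (hmax : limsup (fun n => maxEigenvalue (X n)) atTop < (dmax : EReal))
    -- (A3)
    (hβ₀ : limsup (fun n => ⨆ j, ((|β₀ n j| : ℝ) : EReal)) atTop < ⊤)
    -- (A4)
    (hq : (fun n : ℕ => (Nat.card {j // β₀ n j ≠ 0} : ℝ)) =o[atTop]
      (fun n : ℕ => (n : ℝ) / Real.log n))
    -- hyperparameters
    (b ρ C : ℝ) (hb : 0 < b) (hρ : 0 < ρ) (hC : 0 < C)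
    (aπ : ℕ → ℝ)
    (haπ : ∀ n : ℕ, aπ n = C / ((p n : ℝ) ^ (b / 2) * (n : ℝ) ^ (ρ * b / 2) * Real.log n))
    -- the linear model: for each `n`, i.i.d. centred Gaussian errors
    {Ω : Type*} [MeasurableSpace Ω] (P : Measure Ω) [IsProbabilityMeasure P]
    (e : (n : ℕ) → Fin n → Ω → ℝ)
    (he_law : ∀ n i, HasLaw (e n i) (gaussianReal 0 (σ ^ 2).toNNReal) P)
    (he_indep : ∀ n, iIndepFun (e n) P)
    (Y : (n : ℕ) → Ω → Fin n → ℝ)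
    (hY : ∀ n ω i, Y n ω i = (X n *ᵥ β₀ n) i + e n i ω)
    (ε : ℝ) (hε : 0 < ε) :
    -- in probability
    (∀ δ : ℝ≥0∞, 0 < δ → Tendsto (fun n => P {ω | δ < posteriorProb (X n) σ
        (r2d2Prior (p n) σ (aπ n) b) (Y n ω) {β | ε < ‖WithLp.toLp 2 (β - β₀ n)‖}})
      atTop (𝓝 0)) ∧
    -- almost surely
    (∀ᵐ ω ∂P, Tendsto (fun n => posteriorProb (X n) σ
        (r2d2Prior (p n) σ (aπ n) b) (Y n ω) {β | ε < ‖WithLp.toLp 2 (β - β₀ n)‖})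
      atTop (𝓝 0)) := by
  obtain ⟨M, hM0, hM⟩ : ∃ M : ℝ, 0 ≤ M ∧ ∀ᶠ n in atTop, ∀ j, |β₀ n j| ≤ M := by
    obtain ⟨M, hM, -⟩ := EReal.lt_iff_exists_real_btwn.1 hβ₀
    refine ⟨max M 0, le_max_right _ _, ?_⟩
    filter_upwards [eventually_lt_of_limsup_lt hM] with n hn j
    have : ((|β₀ n j| : ℝ) : EReal) ≤ M :=
      (le_iSup (fun j => ((|β₀ n j| : ℝ) : EReal)) j).trans hn.le
    exact (EReal.coe_le_coe_iff.1 this).trans (le_max_left _ _)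
  -- Taking the maximum with `1` gives a visibly positive upper bound.
  set D : ℝ := max dmax 1 with hD
  have hD0 : 0 < D := one_pos.trans_le (le_max_right _ _)
  have hmax' : limsup (fun n => maxEigenvalue (X n)) atTop < (D : EReal) :=
    hmax.trans_le (EReal.coe_le_coe_iff.2 (le_max_left _ _))
  obtain ⟨r, hr0, hr8, hr2⟩ : ∃ r : ℝ, 0 < r ∧ r ≤ ε / 8 ∧ D * r ^ 2 ≤ dmin * ε ^ 2 / 16 := by
    refine ⟨min (ε / 8) (√(dmin * ε ^ 2 / 16 / D)), by positivity, min_le_left _ _, ?_⟩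
    rw [← le_div_iff₀' hD0]
    calc _ ≤ √(dmin * ε ^ 2 / 16 / D) ^ 2 := by
          gcongr
          exact min_le_right _ _
      _ = _ := Real.sq_sqrt (by positivity)
  -- `c` is the Chernoff rate for `l = n D` and threshold `(dmin ε n / 4)²`. Half of it pays for `2
  -- ^ p ≤ exp p ≤ exp (c n / 2)`, leaving `c / 2`.
  set c : ℝ := (dmin * ε / 4) ^ 2 / (4 * σ ^ 2 * D) with hc
  have hc0 : 0 < c := by positivity
  refine tendsto_zero_of_exp_small _ (fun n => {ω | (dmin * ε / 4 * n) ^ 2 ≤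
    ((X n)ᵀ *ᵥ fun i => e n i ω) ⬝ᵥ ((X n)ᵀ *ᵥ fun i => e n i ω)}) (c := c / 2)
    (d := dmin * ε ^ 2 / (8 * σ ^ 2)) (by positivity) (by positivity) ?_ ?_
  · filter_upwards [eventually_gt_atTop 0, eventually_lt_of_limsup_lt hmax',
      hp.bound (half_pos hc0)] with n hn hn1 hn2
    have hn' : (0 : ℝ) < n := by exact_mod_cast hn
    refine (measure_le_sq_transpose_mulVec_le (X n) hσ (l := n * D) (by positivity)
      (dotProduct_self_mulVec_le hn hn1) P (e n) (he_law n) (he_indep n) _).trans ?_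
    refine ENNReal.ofReal_le_ofReal ?_
    rw [Real.norm_natCast, Real.norm_natCast] at hn2
    have h2 : (2 : ℝ) ^ p n ≤ Real.exp (p n) := by
      rw [← Real.exp_one_pow]
      gcongr
      exact Real.exp_one_gt_two.le
    refine (mul_le_mul_of_nonneg_right h2 (Real.exp_pos _).le).trans ?_
    rw [← Real.exp_add, Real.exp_le_exp]
    have h3 : (dmin * ε / 4 * n) ^ 2 / (4 * σ ^ 2 * (n * D)) = c * n := by
      rw [hc]
      field_simp
    rw [h3]
    linarith
  · have hκ : 0 < dmin * ε ^ 2 / (16 * σ ^ 2) := by positivity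
    have hln : ∀ᶠ n : ℕ in atTop, 1 ≤ Real.log n :=
      (Real.tendsto_log_atTop.comp tendsto_natCast_atTop_atTop).eventually_ge_atTop 1
    filter_upwards [eventually_gt_atTop 0, eventually_lt_of_limsup_lt hmax',
      eventually_lt_of_lt_liminf hmin, hln, hp.bound one_pos,
      eventually_exp_le_r2d2Prior_box p hp_pos β₀ hσ hp hM0 hM hq hb hρ hC aπ haπ hκ hr0]
      with n hn hn1 hn2 hn3 hpn hprior ω hω
    rw [Real.norm_natCast, Real.norm_natCast, one_mul, Nat.cast_le] at hpn
    have ha := (shape_bounds (hp_pos n) hpn hn3 hb hρ hC (haπ n)).1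
    have hYn : Y n ω = X n *ᵥ β₀ n + fun i => e n i ω := funext fun i => hY n ω i
    rw [hYn]
    refine posteriorProb_le (X n) hσ _ (r2d2Prior_univ_le_one _ hσ.le ha hb) _ _ hdmin hε hr8 hr2
      hD0.le (le_dotProduct_self_mulVec hn hn2) (dotProduct_self_mulVec_le hn hn1)
      (le_of_lt (not_le.1 hω)) _ ?_ ?_ hprior
    · rw [Set.ofPred_forall]
      exact MeasurableSet.iInter fun j => measurable_pi_apply j measurableSet_Icc
    · intro β hβ
      refine norm_toLp_le_of_abs_le hr0.le (hp_pos n) fun j => ?_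
      have := hβ j
      rw [Pi.sub_apply, abs_le]
      constructor <;> linarith [this.1, this.2]
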